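/- Let $s>1$ be an integer, $A=\{0,1,\dots,s-1\}$, and for a sequence $(a_n)_{n\ge 1}$ in $A$ write $\Delta^s_{a_1a_2\dots}=\sum_{n\ge1}a_n s^{-n}$. Let $\sigma_1,\dots,\sigma_m$ ($m\ge1$) be distinct non-empty finite words over $A$ that are uniquely decodable, i.e. whenever $\sigma_{i_1}\sigma_{i_2}\cdots\sigma_{i_p}=\sigma_{j_1}\sigma_{j_2}\cdots\sigma_{j_q}$ as words, then $p=q$ and $i_l=j_l$ for all $l$. Let $E$ be the set of all real numbers $x=\Delta^s_{\sigma_{i_1}\sigma_{i_2}\sigma_{i_3}\dots}$, where $(i_n)_{n\ge1}$ ranges over all sequences in $\{1,\dots,m\}$. For $k\ge 1$ let $N_k$ be the number of words of length $k$ among $\sigma_1,\dots,\sigma_m$, and let $K$ be the maximal length of these words, so that $N_1+\dots+N_K=m$. Then the Hausdorff–Besicovitch dimension $\alpha_0$ of $E$ satisfies $$N_1\left(\frac1s\right)^{\alpha_0}+N_2\left(\frac1s\right)^{2\alpha_0}+\dots+N_K\left(\frac1s\right)^{K\alpha_0}=1.$$ -/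

import Mathlib

/-- The digit sequence `a` is the infinite concatenation `w 0, w 1, w 2, …` of digit blocks:
the block `w n` occupies the positions following those of `w 0, …, w (n - 1)`. -/
def IsBlockConcat {s : ℕ} (w : ℕ → List (Fin s)) (a : ℕ → Fin s) : Prop :=
  ∀ n : ℕ, ∀ i : Fin (w n).length,
    a ((∑ j ∈ Finset.range n, (w j).length) + (i : ℕ)) = (w n).get i

/-- The set of all real numbers having an `s`-adic representation
`0.a₀a₁a₂…` that is an infinite concatenation of blocks from `B`
(repetitions allowed, in arbitrary order). -/
def blockSet (s : ℕ) (B : Finset (List (Fin s))) : Set ℝ :=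
  {x : ℝ | ∃ a : ℕ → Fin s, x = Real.ofDigits a ∧
    ∃ w : ℕ → List (Fin s), (∀ n, w n ∈ B) ∧ IsBlockConcat w a}

/-- The number of `k`-digit blocks in the family `B`. -/
def blockCount {s : ℕ} (B : Finset (List (Fin s))) (k : ℕ) : ℕ :=
  (B.filter (fun σ => σ.length = k)).card

/-! Put `θ = s⁻ᵅ` with `α` the root of the equation, so the weights `θ ^ |σ|` sum to 1 over `B`, and
over `p`-tuples of blocks as well. Upper bound (`dimH_blockSet_le`): the cylinders of `p`-tuples
cover the set and their diameters to the power `α` sum to at most 1. Lower bound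
(`le_dimH_blockSet_of_sum_eq_one`): no measure is built. Some length `n ≥ p` is shared by at least
`θ⁻ⁿ / (pK)` of the `p`-tuples, where `K` is the maximal block length. Unique decodability makes
their concatenations distinct, hence distinct digits in base `s ^ n`; half of them, of equal parity,
are pairwise at least 2 apart. Numbers with such digits map onto `[0, 1]` by a Hölder map, which
bounds the dimension below by `α - O(log p / p)`. -/

/-! ### Separated digits -/

/-- The two tails together can offset at most one unit of digit `n`. A gap of 1 would not do, since
0.0999… = 0.1 in base ten. -/
theorem Real.le_abs_ofDigits_sub_ofDigits {b : ℕ} {x y : ℕ → Fin b} {n : ℕ}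
    (hxy : ∀ i < n, x i = y i) (hn : 2 ≤ |((x n : ℕ) : ℤ) - ((y n : ℕ) : ℤ)|) :
    ((b : ℝ) ^ (n + 1))⁻¹ ≤ |Real.ofDigits x - Real.ofDigits y| := by
  have hb : (0 : ℝ) < b := by exact_mod_cast Fin.pos (x 0)
  have hsum : ∑ i ∈ Finset.range n, Real.ofDigitsTerm x i =
      ∑ i ∈ Finset.range n, Real.ofDigitsTerm y i :=
    Finset.sum_congr rfl fun i hi ↦ by
      simp [Real.ofDigitsTerm, hxy i (Finset.mem_range.mp hi)]
  have hn' : (2 : ℝ) ≤ |((x n : ℕ) : ℝ) - ((y n : ℕ) : ℝ)| := by exact_mod_cast hn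
  rw [Real.ofDigits_eq_sum_add_ofDigits x (n + 1), Real.ofDigits_eq_sum_add_ofDigits y (n + 1),
    Finset.sum_range_succ, Finset.sum_range_succ, hsum]
  simp only [Real.ofDigitsTerm]
  set u := Real.ofDigits fun i ↦ x (i + (n + 1))
  set v := Real.ofDigits fun i ↦ y (i + (n + 1))
  have hu0 : 0 ≤ u := Real.ofDigits_nonneg _
  have hu1 : u ≤ 1 := Real.ofDigits_le_one _
  have hv0 : 0 ≤ v := Real.ofDigits_nonneg _
  have hv1 : v ≤ 1 := Real.ofDigits_le_one _
  set q := ((b : ℝ) ^ (n + 1))⁻¹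
  have hq : 0 < q := by positivity
  have key : 1 ≤ |((x n : ℕ) : ℝ) - ((y n : ℕ) : ℝ) + (u - v)| := by
    rcases le_abs.mp hn' with h | h
    · exact le_abs.mpr (Or.inl (by linarith))
    · exact le_abs.mpr (Or.inr (by linarith))
  calc q = q * 1 := (mul_one q).symm
    _ ≤ q * |((x n : ℕ) : ℝ) - ((y n : ℕ) : ℝ) + (u - v)| := by gcongr
    _ = |q * (((x n : ℕ) : ℝ) - ((y n : ℕ) : ℝ) + (u - v))| := by
      rw [abs_mul, abs_of_pos hq]
    _ = _ := by congr 1; ring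

/-- The set of reals whose base `b` digits are all taken from `D` digits with pairwise distance at
least two has Hausdorff dimension at least `log D / log b`. -/
theorem le_dimH_range_ofDigits_of_separated {D b : ℕ} (c : Fin D → Fin b)
    (hc : ∀ i j, i ≠ j → 2 ≤ |((c i : ℕ) : ℤ) - ((c j : ℕ) : ℤ)|) :
    ENNReal.ofReal (Real.log D / Real.log b) ≤
      dimH (Set.range fun d : ℕ → Fin D ↦ Real.ofDigits fun i ↦ c (d i)) := by
  rcases Nat.lt_or_ge 1 D with hD | hD
  swap
  · have : Real.log D = 0 := by
      interval_cases D <;> simp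
    simp [this]
  have hcinj : Function.Injective c := by
    intro i j hij
    by_contra hne
    have := hc i j hne
    simp [hij] at this
  have hb : 1 < b := hD.trans_le (by simpa using Fintype.card_le_of_injective c hcinj)
  have hD0 : (0 : ℝ) < D := by positivity
  have hb0 : (0 : ℝ) < b := by positivity
  have hlogD : 0 < Real.log D := Real.log_pos (by exact_mod_cast hD)
  have hlogb : 0 < Real.log b := Real.log_pos (by exact_mod_cast hb)
  set r : NNReal := (Real.log D / Real.log b).toNNReal with hr
  have hr0 : 0 < r := by rw [hr, Real.toNNReal_pos]; positivity
  have hrc : (r : ℝ) = Real.log D / Real.log b := Real.coe_toNNReal _ (by positivity)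
  have hbr : (b : ℝ) ^ (r : ℝ) = D := by
    rw [Real.rpow_def_of_pos hb0, hrc, mul_div_cancel₀ _ hlogb.ne', Real.exp_log hD0]
  set Φ : (ℕ → Fin D) → ℝ := fun d ↦ Real.ofDigits fun i ↦ c (d i) with hΦ
  -- Rereading the same digit indices in base `D` is Hölder of exponent `r`, because `b ^ r = D`.
  have hold : ∀ d d' : ℕ → Fin D,
      |Real.ofDigits d - Real.ofDigits d'| ≤ D * |Φ d - Φ d'| ^ (r : ℝ) := by
    intro d d'
    by_cases hdd : d = d'
    · subst hdd
      simp only [sub_self, abs_zero]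
      positivity
    have hex : ∃ k, d k ≠ d' k := Function.ne_iff.mp hdd
    classical
    have hk := Nat.find_spec hex
    have hmin : ∀ i < Nat.find hex, d i = d' i := fun i hi ↦ by
      simpa using Nat.find_min hex hi
    set k := Nat.find hex
    have h1 := Real.abs_ofDigits_sub_ofDigits_le hmin
    have h2 : ((b : ℝ) ^ (k + 1))⁻¹ ≤ |Φ d - Φ d'| :=
      Real.le_abs_ofDigits_sub_ofDigits (fun i hi ↦ by rw [hmin i hi]) (hc _ _ hk)
    have h3 : (((b : ℝ) ^ (k + 1))⁻¹) ^ (r : ℝ) = ((D : ℝ) ^ (k + 1))⁻¹ := by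
      rw [Real.inv_rpow (by positivity), ← Real.rpow_natCast, ← Real.rpow_mul hb0.le, mul_comm,
        Real.rpow_mul hb0.le, hbr, Real.rpow_natCast]
    calc |Real.ofDigits d - Real.ofDigits d'| ≤ ((D : ℝ) ^ k)⁻¹ := h1
      _ = D * ((D : ℝ) ^ (k + 1))⁻¹ := by
        rw [pow_succ', mul_inv, mul_inv_cancel_left₀ hD0.ne']
      _ = D * (((b : ℝ) ^ (k + 1))⁻¹) ^ (r : ℝ) := by rw [h3]
      _ ≤ _ := by gcongr
  have : Nonempty (ℕ → Fin D) := ⟨fun _ ↦ ⟨0, by omega⟩⟩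
  -- The choice of preimage does not matter: by `hold`, equal values of `Φ` give equal base `D`
  -- values.
  have hΦg : ∀ d, Real.ofDigits (Function.invFun Φ (Φ d)) = Real.ofDigits d := by
    intro d
    have hinv : Φ (Function.invFun Φ (Φ d)) = Φ d := Function.invFun_eq ⟨d, rfl⟩
    have := hold (Function.invFun Φ (Φ d)) d
    rw [hinv, sub_self, abs_zero, Real.zero_rpow (by exact_mod_cast hr0.ne'), mul_zero] at this
    exact sub_eq_zero.mp (abs_nonpos_iff.mp this)
  have hholder : HolderOnWith (D : NNReal) r (fun x ↦ Real.ofDigits (Function.invFun Φ x))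
      (Set.range Φ) := by
    rintro _ ⟨d, rfl⟩ _ ⟨d', rfl⟩
    simp only [hΦg]
    rw [edist_dist, edist_dist, Real.dist_eq, Real.dist_eq,
      ENNReal.ofReal_rpow_of_nonneg (abs_nonneg _) r.coe_nonneg]
    have hDc : ((D : NNReal) : ENNReal) = ENNReal.ofReal (D : ℝ) := by simp
    rw [hDc, ← ENNReal.ofReal_mul hD0.le]
    exact ENNReal.ofReal_le_ofReal (hold d d')
  have himage : Set.Icc (0 : ℝ) 1 ⊆
      (fun x ↦ Real.ofDigits (Function.invFun Φ x)) '' Set.range Φ := by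
    intro y hy
    obtain ⟨d, -, rfl⟩ := Real.ofDigits_SurjOn hD hy
    exact ⟨Φ d, ⟨d, rfl⟩, hΦg d⟩
  have hIcc : dimH (Set.Icc (0 : ℝ) 1) = 1 := by
    simpa using Real.dimH_of_nonempty_interior (E := ℝ) (s := Set.Icc 0 1) (by simp)
  have hle : 1 ≤ dimH (Set.range Φ) / r := by
    rw [← hIcc]
    exact (dimH_mono himage).trans (hholder.dimH_image_le hr0)
  have := (ENNReal.le_div_iff_mul_le (Or.inl (by exact_mod_cast hr0.ne'))
    (Or.inl ENNReal.coe_ne_top)).mp hle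
  rw [one_mul] at this
  exact this

/-! ### Groups of blocks as digits in base `s ^ n` -/

/-- The integer in `[0, s ^ n)` with the given base `s` digits, the leading one first. -/
def wordValue {s n : ℕ} (f : Fin n → Fin s) : Fin (s ^ n) :=
  finFunctionFinEquiv fun i ↦ f i.rev

theorem wordValue_injective {s n : ℕ} :
    Function.Injective (wordValue : (Fin n → Fin s) → Fin (s ^ n)) := by
  intro f g h
  have := finFunctionFinEquiv.injective h
  funext i
  simpa using congrFun this i.rev

theorem wordValue_eq_sum {s n : ℕ} (f : Fin n → Fin s) :
    (wordValue f : ℕ) = ∑ i : Fin n, (f i : ℕ) * s ^ (n - 1 - i) := by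
  rw [wordValue, finFunctionFinEquiv_apply, ← Equiv.sum_comp Fin.revPerm]
  refine Finset.sum_congr rfl fun i _ ↦ ?_
  simp only [Fin.revPerm_apply, Fin.rev_rev, Fin.val_rev]
  congr 2
  omega

theorem Real.ofDigits_wordValue {s n : ℕ} (hs : 0 < s) (hn : 0 < n) (f : ℕ → Fin n → Fin s) :
    Real.ofDigits (fun q ↦ wordValue (f q)) =
      Real.ofDigits fun j ↦ f (j / n) ⟨j % n, Nat.mod_lt j hn⟩ := by
  have : NeZero n := ⟨hn.ne'⟩
  have hs0 : (s : ℝ) ≠ 0 := by positivity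
  set a : ℕ → Fin s := fun j ↦ f (j / n) ⟨j % n, Nat.mod_lt j hn⟩ with ha
  have hsum : Summable (Real.ofDigitsTerm a) := Real.summable_ofDigitsTerm
  have hsum' : Summable fun x : ℕ × Fin n ↦
      Real.ofDigitsTerm a ((Nat.divModEquiv n).symm x) :=
    (Nat.divModEquiv n).symm.summable_iff.mpr hsum
  rw [Real.ofDigits, Real.ofDigits,
    ← (Nat.divModEquiv n).symm.tsum_eq (Real.ofDigitsTerm a), hsum'.tsum_prod]
  refine tsum_congr fun q ↦ ?_
  rw [tsum_fintype, Real.ofDigitsTerm, wordValue_eq_sum]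
  push_cast
  rw [Finset.sum_mul]
  refine Finset.sum_congr rfl fun i _ ↦ ?_
  have hi := i.2
  have hdiv : (i.1 + q * n) / n = q := by
    rw [Nat.add_mul_div_right _ _ hn, Nat.div_eq_of_lt hi, zero_add]
  have hmod : (i.1 + q * n) % n = i := by
    rw [Nat.add_mul_mod_self_right, Nat.mod_eq_of_lt hi]
  have hai : a (i.1 + q * n) = f q i := by
    simp only [ha, hdiv, hmod]
  have hidx : (Nat.divModEquiv n).symm (q, i) = i.1 + q * n := by
    simp [Nat.divModEquiv, add_comm, mul_comm]
  rw [Real.ofDigitsTerm, hidx, hai, mul_assoc, ← pow_mul]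
  congr 1
  rw [← div_eq_mul_inv, div_eq_iff (by positivity), ← div_eq_inv_mul, eq_div_iff (by positivity),
    ← pow_add]
  congr 1
  have : n - 1 - i.1 + i.1 + 1 = n := by omega
  calc n - 1 - i.1 + (i.1 + q * n + 1) = (n - 1 - i.1 + i.1 + 1) + q * n := by ring
    _ = n * (q + 1) := by rw [this]; ring

theorem List.getElem?_flatten_map_range {α : Type*} (v : ℕ → List α) {p r i : ℕ} (hr : r < p)
    (hi : i < (v r).length) :
    ((List.range p).map v).flatten[(∑ l ∈ Finset.range r, (v l).length) + i]? = (v r)[i]? := by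
  obtain ⟨k, rfl⟩ := Nat.exists_eq_add_of_lt hr
  have hlen (m : ℕ) :
      ((List.range m).map v).flatten.length = ∑ l ∈ Finset.range m, (v l).length := by
    induction m with
    | zero => simp
    | succ m ih =>
      rw [List.range_succ, List.map_append, List.flatten_append, List.length_append, ih,
        Finset.sum_range_succ]
      simp
  have hsplit : List.range (r + k + 1) = List.range r ++ r :: (List.range k).map (r + 1 + ·) := by
    rw [show r + k + 1 = r + 1 + k by ring, List.range_add, List.range_succ]
    simp
  rw [hsplit, List.map_append, List.flatten_append, List.map_cons, List.flatten_cons, ← hlen,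
    List.getElem?_append_right (by omega), Nat.add_sub_cancel_left,
    List.getElem?_append_left hi]

/-- Grouping the blocks `w` into consecutive groups of `p` blocks, each of total length `n`, the
concatenation of `w` can be read off from the sequence of the `n`-digit words of the groups. -/
theorem isBlockConcat_of_groups {s p n : ℕ} (hp : 0 < p) (hn : 0 < n) (w : ℕ → List (Fin s))
    (f : ℕ → Fin n → Fin s)
    (h : ∀ q, ((List.range p).map fun l ↦ w (q * p + l)).flatten = List.ofFn (f q)) :
    IsBlockConcat w fun j ↦ f (j / n) ⟨j % n, Nat.mod_lt j hn⟩ := by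
  have hsum : ∀ q, ∑ j ∈ Finset.range (q * p), (w j).length = q * n := by
    intro q
    induction q with
    | zero => simp
    | succ q ih =>
      have hq := congrArg List.length (h q)
      rw [List.length_ofFn, List.length_flatten, List.map_map] at hq
      rw [add_mul, one_mul, Finset.sum_range_add, ih, add_mul, one_mul, ← hq,
        Finset.sum_range, ← List.sum_ofFn]
      congr 2
      exact List.ext_getElem (by simp) (by simp)
  intro m i
  obtain ⟨q, r, hr, rfl⟩ : ∃ q r, r < p ∧ m = q * p + r :=
    ⟨m / p, m % p, Nat.mod_lt m hp, by rw [mul_comm, Nat.div_add_mod]⟩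
  have key := List.getElem?_flatten_map_range (fun l ↦ w (q * p + l)) hr i.2
  rw [h q] at key
  rw [Finset.sum_range_add, hsum]
  set u := ∑ l ∈ Finset.range r, (w (q * p + l)).length
  have hlt : u + i < n := by
    by_contra hge
    rw [List.getElem?_eq_none (by simpa using not_lt.mp hge)] at key
    simp at key
  have hdiv : (q * n + u + i) / n = q := by
    rw [add_assoc, mul_comm, Nat.mul_add_div hn, Nat.div_eq_of_lt hlt, add_zero]
  have hmod : (q * n + u + i) % n = u + i := by
    rw [add_assoc, mul_comm, Nat.mul_add_mod, Nat.mod_eq_of_lt hlt]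
  simp only [hdiv, hmod]
  simpa [hlt] using key

/-- The concatenation of a finite tuple of blocks. -/
def concatTuple {α : Type*} {B : Finset (List α)} {p : ℕ} (t : Fin p → B) : List α :=
  (List.ofFn fun i ↦ (t i : List α)).flatten

theorem length_concatTuple {α : Type*} {B : Finset (List α)} {p : ℕ} (t : Fin p → B) :
    (concatTuple t).length = ∑ i, (t i : List α).length := by
  simp [concatTuple, List.sum_ofFn]

theorem concatTuple_injective {α : Type*} {B : Finset (List α)}
    (hB : InformationTheory.UniquelyDecodable (B : Set (List α))) (p : ℕ) :
    Function.Injective (concatTuple : (Fin p → B) → List α) := by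
  intro t u h
  have := List.ofFn_injective (hB _ _ (by simp) (by simp) h)
  funext i
  exact Subtype.ext (congrFun this i)

/-- The factor 1/2 pays for keeping only words whose values have one parity: distinct values then
differ by at least 2. -/
theorem le_dimH_blockSet {s : ℕ} (hs : 1 < s) {B : Finset (List (Fin s))}
    (hB : InformationTheory.UniquelyDecodable (B : Set (List (Fin s)))) {p n : ℕ}
    (hp : 0 < p) (hn : 0 < n) {X : Finset (Fin p → B)} (hXne : X.Nonempty)
    (hX : ∀ t ∈ X, (concatTuple t).length = n) :
    ENNReal.ofReal (Real.log (X.card / 2) / Real.log ((s : ℝ) ^ n)) ≤ dimH (blockSet s B) := by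
  classical
  let word : X → Fin n → Fin s := fun t i ↦ (concatTuple t.1).get (i.cast (hX t.1 t.2).symm)
  have hword : ∀ t : X, List.ofFn (word t) = concatTuple t.1 := fun t ↦
    List.ext_getElem (by simp [hX t.1 t.2]) (by simp [word])
  have hinj : Function.Injective fun t : X ↦ wordValue (word t) := by
    intro t u h
    have := congrArg List.ofFn (wordValue_injective h)
    rw [hword, hword] at this
    exact Subtype.ext (concatTuple_injective hB p this)
  obtain ⟨ε, hε⟩ := Fintype.exists_le_card_fiber_of_nsmul_le_card
    (fun t : X ↦ ((wordValue (word t) : ℕ) : ZMod 2)) (b := (X.card : ℝ) / 2)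
    (by simp [ZMod.card, mul_div_cancel₀])
  set Y := Finset.univ.filter fun t : X ↦ ((wordValue (word t) : ℕ) : ZMod 2) = ε with hY
  let c : Fin Y.card → X := fun i ↦ (Y.equivFin.symm i).1
  have hcinj : Function.Injective c :=
    Subtype.val_injective.comp Y.equivFin.symm.injective
  have hcY : ∀ i, ((wordValue (word (c i)) : ℕ) : ZMod 2) = ε := fun i ↦
    (Finset.mem_filter.mp (Y.equivFin.symm i).2).2
  have hsep : ∀ i j, i ≠ j →
      2 ≤ |((wordValue (word (c i)) : ℕ) : ℤ) - ((wordValue (word (c j)) : ℕ) : ℤ)| := by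
    intro i j hij
    have hne : ((wordValue (word (c i)) : ℕ) : ℤ) - ((wordValue (word (c j)) : ℕ) : ℤ) ≠ 0 := by
      intro h
      exact hij (hcinj (hinj (Fin.ext (by exact_mod_cast sub_eq_zero.mp h))))
    refine Int.le_of_dvd (abs_pos.mpr hne) ((dvd_abs _ _).mpr ?_)
    refine (CharP.intCast_eq_zero_iff (ZMod 2) 2 _).mp ?_
    push_cast
    rw [hcY, hcY, sub_self]
  have hXpos : (0 : ℝ) < X.card := by exact_mod_cast hXne.card_pos
  have hlogs : 0 < Real.log ((s : ℝ) ^ n) :=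
    Real.log_pos (one_lt_pow₀ (by exact_mod_cast hs) hn.ne')
  refine le_trans ?_ ((le_dimH_range_ofDigits_of_separated _ hsep).trans (dimH_mono ?_))
  · push_cast
    exact ENNReal.ofReal_le_ofReal (by gcongr)
  · rintro _ ⟨d, rfl⟩
    simp only
    rw [Real.ofDigits_wordValue (by omega) hn fun q ↦ word (c (d q))]
    refine ⟨_, rfl, fun j ↦ ((c (d (j / p))).1 ⟨j % p, Nat.mod_lt j hp⟩ : List (Fin s)),
      fun j ↦ Subtype.prop _, isBlockConcat_of_groups hp hn _ (fun q ↦ word (c (d q))) fun q ↦ ?_⟩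
    rw [hword, concatTuple]
    congr 1
    refine List.ext_getElem (by simp) fun i h₁ h₂ ↦ ?_
    have hi : i < p := by simpa using h₁
    have hdiv : (q * p + i) / p = q := by
      rw [mul_comm, Nat.mul_add_div hp, Nat.div_eq_of_lt hi, add_zero]
    simp [hdiv, Nat.mod_eq_of_lt hi]

/-! ### Upper bound by cylinders -/

theorem IsBlockConcat.eq_of_forall_lt {s : ℕ} {w w' : ℕ → List (Fin s)} {a a' : ℕ → Fin s}
    (h : IsBlockConcat w a) (h' : IsBlockConcat w' a') {p : ℕ} (hw : ∀ j < p, w j = w' j) :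
    ∀ i < ∑ j ∈ Finset.range p, (w j).length, a i = a' i := by
  induction p with
  | zero => simp
  | succ p ih =>
    intro i hi
    rw [Finset.sum_range_succ] at hi
    rcases lt_or_ge i (∑ j ∈ Finset.range p, (w j).length) with hlt | hge
    · exact ih (fun j hj ↦ hw j (by omega)) i hlt
    · obtain ⟨k, rfl⟩ := Nat.exists_eq_add_of_le hge
      have hsum : ∑ j ∈ Finset.range p, (w j).length = ∑ j ∈ Finset.range p, (w' j).length :=
        Finset.sum_congr rfl fun j hj ↦ by
          rw [hw j (by have := Finset.mem_range.mp hj; omega)]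
      have hk : k < (w p).length := by omega
      have hk' : k < (w' p).length := by rwa [← hw p (by omega)]
      have e := h p ⟨k, hk⟩
      have e' := h' p ⟨k, hk'⟩
      simp only at e e'
      rw [e, hsum, e']
      simp [hw p (by omega)]

theorem sum_pow_length_concatTuple {α : Type*} (B : Finset (List α)) (θ : ℝ) (p : ℕ) :
    ∑ t : Fin p → B, θ ^ (concatTuple t).length = (∑ σ ∈ B, θ ^ σ.length) ^ p := by
  rw [← Finset.sum_coe_sort B fun σ ↦ θ ^ σ.length, Fintype.sum_pow]
  refine Finset.sum_congr rfl fun t _ ↦ ?_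
  rw [length_concatTuple, Finset.prod_pow_eq_pow_sum]

theorem le_length_concatTuple {α : Type*} {B : Finset (List α)} (hnil : [] ∉ B) {p : ℕ}
    (t : Fin p → B) : p ≤ (concatTuple t).length := by
  rw [length_concatTuple]
  have : ∑ _ : Fin p, 1 ≤ ∑ i, (t i : List α).length :=
    Finset.sum_le_sum fun i _ ↦ List.length_pos_iff.mpr fun h ↦ hnil (h ▸ (t i).2)
  simpa using this

theorem length_concatTuple_le {α : Type*} {B : Finset (List α)} {p : ℕ} (t : Fin p → B) :
    (concatTuple t).length ≤ p * B.sup List.length := by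
  rw [length_concatTuple]
  exact (Finset.sum_le_sum fun i _ ↦ Finset.le_sup (t i).2).trans_eq (by simp)

theorem dimH_blockSet_le {s : ℕ} (hs : 1 < s) {B : Finset (List (Fin s))} (hnil : [] ∉ B)
    (α : NNReal) (hα : ∑ σ ∈ B, (((1 : ℝ) / s) ^ (α : ℝ)) ^ σ.length = 1) :
    dimH (blockSet s B) ≤ α := by
  have hs0 : (0 : ℝ) < s := by positivity
  have hs1 : (1 : ℝ) < s := by exact_mod_cast hs
  -- Blocks after the first `p` are left unrestricted; only the common prefix matters for the
  -- diameter.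
  let cyl : ∀ p : ℕ, (Fin p → B) → Set ℝ := fun p t ↦
    {x | ∃ a : ℕ → Fin s, x = Real.ofDigits a ∧ ∃ w : ℕ → List (Fin s),
      IsBlockConcat w a ∧ ∀ i : Fin p, w i = t i}
  have hdiam : ∀ p (t : Fin p → B),
      Metric.ediam (cyl p t) ≤ ENNReal.ofReal (((1 : ℝ) / s) ^ (concatTuple t).length) := by
    intro p t
    refine Metric.ediam_le ?_
    rintro _ ⟨a, rfl, w, hwa, hw⟩ _ ⟨a', rfl, w', hwa', hw'⟩
    rw [edist_dist, Real.dist_eq, one_div, inv_pow]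
    refine ENNReal.ofReal_le_ofReal (Real.abs_ofDigits_sub_ofDigits_le ?_)
    have hlen : (concatTuple t).length = ∑ j ∈ Finset.range p, (w j).length := by
      rw [length_concatTuple, Finset.sum_range]
      exact Finset.sum_congr rfl fun i _ ↦ by rw [hw i]
    rw [hlen]
    exact hwa.eq_of_forall_lt hwa' fun j hj ↦ (hw ⟨j, hj⟩).trans (hw' ⟨j, hj⟩).symm
  refine dimH_le_of_hausdorffMeasure_ne_top (ne_top_of_le_ne_top ENNReal.one_ne_top ?_)
  have hlim : Filter.Tendsto (fun p : ℕ ↦ ENNReal.ofReal (((1 : ℝ) / s) ^ p)) Filter.atTop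
      (nhds 0) := by
    rw [← ENNReal.ofReal_zero]
    exact ENNReal.tendsto_ofReal (tendsto_pow_atTop_nhds_zero_of_lt_one (by positivity)
      ((div_lt_one hs0).mpr hs1))
  refine (MeasureTheory.Measure.hausdorffMeasure_le_liminf_sum (α : ℝ) (blockSet s B) _ hlim cyl
    (Filter.Eventually.of_forall fun p t ↦ (hdiam p t).trans (ENNReal.ofReal_le_ofReal
      (pow_le_pow_of_le_one (by positivity) ((div_le_one hs0).mpr hs1.le)
        (le_length_concatTuple hnil t))))
    (Filter.Eventually.of_forall fun p ↦ ?_)).trans ?_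
  · rintro x ⟨a, rfl, w, hwB, hwa⟩
    exact Set.mem_iUnion.mpr ⟨fun i ↦ ⟨w i, hwB i⟩, a, rfl, w, hwa, fun i ↦ rfl⟩
  · refine (Filter.liminf_le_liminf (v := fun _ ↦ (1 : ENNReal))
      (Filter.Eventually.of_forall fun p ↦ ?_)).trans_eq (Filter.liminf_const _)
    calc ∑ t, Metric.ediam (cyl p t) ^ (α : ℝ)
        ≤ ∑ t : Fin p → B,
            ENNReal.ofReal ((((1 : ℝ) / s) ^ (α : ℝ)) ^ (concatTuple t).length) := by
          refine Finset.sum_le_sum fun t _ ↦ ?_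
          refine (ENNReal.rpow_le_rpow (hdiam p t) α.coe_nonneg).trans_eq ?_
          rw [ENNReal.ofReal_rpow_of_nonneg (by positivity) α.coe_nonneg, ← Real.rpow_natCast,
            ← Real.rpow_mul (by positivity), mul_comm, Real.rpow_mul (by positivity),
            Real.rpow_natCast]
      _ = 1 := by
          rw [← ENNReal.ofReal_sum_of_nonneg fun _ _ ↦ by positivity,
            sum_pow_length_concatTuple, hα, one_pow, ENNReal.ofReal_one]

/-! ### Lower bound -/

/-- By pigeonhole, among the `p`-tuples of blocks there are many with a common total length. -/
theorem exists_card_concatTuple_length {α : Type*} {B : Finset (List α)} (hnil : [] ∉ B) {θ : ℝ}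
    (hθ : ∑ σ ∈ B, θ ^ σ.length = 1) {p : ℕ} (hp : 0 < p) :
    ∃ n, p ≤ n ∧ ∃ X : Finset (Fin p → B), (∀ t ∈ X, (concatTuple t).length = n) ∧
      1 ≤ (p * B.sup List.length : ℕ) * (X.card * θ ^ n) := by
  classical
  set I := Finset.Icc p (p * B.sup List.length) with hI
  have hmaps : ∀ t ∈ (Finset.univ : Finset (Fin p → B)), (concatTuple t).length ∈ I :=
    fun t _ ↦ Finset.mem_Icc.mpr ⟨le_length_concatTuple hnil t, length_concatTuple_le t⟩
  have htot : ∑ n ∈ I, ((Finset.univ.filter fun t : Fin p → B ↦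
      (concatTuple t).length = n).card : ℝ) * θ ^ n = 1 := by
    have h1 := sum_pow_length_concatTuple B θ p
    rw [hθ, one_pow, ← Finset.sum_fiberwise_of_maps_to hmaps] at h1
    rw [← h1]
    refine Finset.sum_congr rfl fun n _ ↦ ?_
    rw [← nsmul_eq_mul, ← Finset.sum_const]
    exact Finset.sum_congr rfl fun t ht ↦ by rw [(Finset.mem_filter.mp ht).2]
  by_contra! hcon
  have hcard : (I.card : ℝ) ≤ (p * B.sup List.length : ℕ) := by
    rw [hI, Nat.card_Icc]
    exact_mod_cast by omega
  have hIne : I.Nonempty := by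
    rw [Finset.nonempty_iff_ne_empty]
    intro h
    rw [h] at htot
    simp at htot
  have hlt : ∑ n ∈ I, (p * B.sup List.length : ℕ) * (((Finset.univ.filter fun t : Fin p → B ↦
      (concatTuple t).length = n).card : ℝ) * θ ^ n) < ∑ n ∈ I, 1 :=
    Finset.sum_lt_sum_of_nonempty hIne fun n hn ↦
      hcon n (Finset.mem_Icc.mp hn).1 _ fun t ht ↦ (Finset.mem_filter.mp ht).2
  rw [← Finset.mul_sum, htot] at hlt
  simp only [Finset.sum_const, nsmul_eq_mul, mul_one] at hlt
  linarith

theorem le_dimH_blockSet_of_sum_eq_one {s : ℕ} (hs : 1 < s) {B : Finset (List (Fin s))}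
    (hB : InformationTheory.UniquelyDecodable (B : Set (List (Fin s))))
    (α : NNReal) (hα : ∑ σ ∈ B, (((1 : ℝ) / s) ^ (α : ℝ)) ^ σ.length = 1) :
    (α : ENNReal) ≤ dimH (blockSet s B) := by
  have hnil : [] ∉ B := by simpa using hB.epsilon_not_mem
  have hs0 : (0 : ℝ) < s := by positivity
  have hs1 : (1 : ℝ) < s := by exact_mod_cast hs
  have hlogs : 0 < Real.log s := Real.log_pos hs1
  set K := B.sup List.length
  set θ := ((1 : ℝ) / s) ^ (α : ℝ) with hθ
  have hθ0 : 0 < θ := by positivity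
  have hlogθ : Real.log θ = -(α * Real.log s) := by
    rw [hθ, Real.log_rpow (by positivity), one_div, Real.log_inv]; ring
  -- The error collects the pigeonhole loss `pK` and the parity loss 2; `n` is replaced by `p ≤ n`,
  -- so that the limit depends on `p` alone.
  have hlim : Filter.Tendsto
      (fun p : ℕ ↦ ENNReal.ofReal (α - (Real.log (2 * K) + Real.log p) / (p * Real.log s)))
      Filter.atTop (nhds α) := by
    rw [← ENNReal.ofReal_coe_nnreal]
    refine ENNReal.tendsto_ofReal ?_
    have h1 : Filter.Tendsto (fun p : ℕ ↦ Real.log p / (p : ℝ)) Filter.atTop (nhds 0) :=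
      (Real.isLittleO_log_id_atTop.tendsto_div_nhds_zero).comp tendsto_natCast_atTop_atTop
    have h2 : Filter.Tendsto (fun p : ℕ ↦ Real.log (2 * K) / (p : ℝ)) Filter.atTop (nhds 0) :=
      tendsto_const_div_atTop_nhds_zero_nat _
    have h3 := ((h2.add h1).div_const (Real.log s)).const_sub (α : ℝ)
    simp only [add_zero, zero_div, sub_zero] at h3
    refine h3.congr fun p ↦ ?_
    rw [← add_div, div_div]
  refine le_of_tendsto hlim ((Filter.eventually_gt_atTop 0).mono fun p hp ↦ ?_)
  obtain ⟨n, hpn, X, hX, hcard⟩ := exists_card_concatTuple_length hnil hα hp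
  have hn : 0 < n := hp.trans_le hpn
  have hp0 : (0 : ℝ) < p := by exact_mod_cast hp
  have hXne : X.Nonempty := by
    rw [Finset.nonempty_iff_ne_empty]
    rintro rfl
    norm_num at hcard
  have hX0 : (0 : ℝ) < X.card := by exact_mod_cast hXne.card_pos
  have hK : 0 < K := by
    rw [Nat.pos_iff_ne_zero]
    intro h
    change 1 ≤ ((p * K : ℕ) : ℝ) * _ at hcard
    norm_num [h] at hcard
  have hK0 : (0 : ℝ) < K := by exact_mod_cast hK
  have hlogcard : 0 ≤ Real.log (2 * K) + Real.log p + Real.log (X.card / 2) -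
      n * (α * Real.log s) := by
    have := Real.log_nonneg hcard
    have e : ((p * K : ℕ) : ℝ) * (X.card * θ ^ n) = 2 * K * p * (X.card / 2) * θ ^ n := by
      push_cast; ring
    change 0 ≤ Real.log (((p * K : ℕ) : ℝ) * (X.card * θ ^ n)) at this
    rw [e, Real.log_mul (by positivity) (by positivity), Real.log_mul (by positivity)
      (by positivity), Real.log_mul (by positivity) (by positivity), Real.log_pow, hlogθ] at this
    linarith
  have hnonneg : 0 ≤ Real.log (2 * K) + Real.log p := by
    have hK1 : (1 : ℝ) ≤ K := by exact_mod_cast hK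
    exact add_nonneg (Real.log_nonneg (by linarith)) (Real.log_nonneg (by exact_mod_cast hp))
  refine le_trans (ENNReal.ofReal_le_ofReal ?_) (le_dimH_blockSet hs hB hp hn hXne hX)
  have hn0 : (0 : ℝ) < n := by exact_mod_cast hn
  rw [Real.log_pow]
  calc (α : ℝ) - (Real.log (2 * K) + Real.log p) / (p * Real.log s)
      ≤ α - (Real.log (2 * K) + Real.log p) / (n * Real.log s) := by gcongr
    _ ≤ Real.log (X.card / 2) / (n * Real.log s) := by
      rw [sub_le_iff_le_add, ← add_div, le_div_iff₀ (by positivity)]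
      linarith

/-! ### Solving the dimension equation -/

/-- Intermediate values on `[0, B.card]`: the right endpoint is large enough because `m < s ^ m`. -/
theorem exists_sum_rpow_pow_length_eq_one {s : ℕ} (hs : 1 < s) {β : Type*} {B : Finset (List β)}
    (hne : B.Nonempty) (hnil : [] ∉ B) :
    ∃ α : NNReal, ∑ σ ∈ B, (((1 : ℝ) / s) ^ (α : ℝ)) ^ σ.length = 1 := by
  have hs0 : (0 : ℝ) < s := by positivity
  have hs1 : (1 : ℝ) < s := by exact_mod_cast hs
  have hcont : ContinuousOn (fun x : ℝ ↦ ∑ σ ∈ B, (((1 : ℝ) / s) ^ x) ^ σ.length)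
      (Set.Icc 0 (B.card : ℝ)) :=
    (continuous_finsetSum _ fun σ _ ↦
      (Real.continuous_const_rpow (by positivity)).pow _).continuousOn
  have hzero : 1 ≤ ∑ σ ∈ B, (((1 : ℝ) / s) ^ (0 : ℝ)) ^ σ.length := by
    simpa using hne.card_pos
  have hcard : ∑ σ ∈ B, (((1 : ℝ) / s) ^ (B.card : ℝ)) ^ σ.length ≤ 1 := by
    rw [Real.rpow_natCast]
    have hle : ((1 : ℝ) / s) ^ B.card ≤ 1 :=
      pow_le_one₀ (by positivity) ((div_le_one hs0).mpr hs1.le)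
    calc ∑ σ ∈ B, (((1 : ℝ) / s) ^ B.card) ^ σ.length
        ≤ ∑ σ ∈ B, ((1 : ℝ) / s) ^ B.card := Finset.sum_le_sum fun σ hσ ↦
          pow_le_of_le_one (by positivity) hle
            (List.length_pos_iff.mpr fun h ↦ hnil (h ▸ hσ)).ne'
      _ = B.card / (s : ℝ) ^ B.card := by
          rw [Finset.sum_const, nsmul_eq_mul, one_div, inv_pow, div_eq_mul_inv]
      _ ≤ 1 := by
          rw [div_le_one (by positivity)]
          exact_mod_cast (Nat.lt_pow_self hs).le
  obtain ⟨x, hx, hx1⟩ := intermediate_value_Icc' (Nat.cast_nonneg _) hcont ⟨hcard, hzero⟩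
  exact ⟨⟨x, hx.1⟩, hx1⟩

theorem sum_blockCount_mul {s : ℕ} {R : Type*} [CommSemiring R] {B : Finset (List (Fin s))}
    (hnil : [] ∉ B) (g : ℕ → R) :
    ∑ k ∈ Finset.Icc 1 (B.sup List.length), (blockCount B k : R) * g k =
      ∑ σ ∈ B, g σ.length := by
  have hmaps : ∀ σ ∈ B, σ.length ∈ Finset.Icc 1 (B.sup List.length) := fun σ hσ ↦
    Finset.mem_Icc.mpr ⟨List.length_pos_iff.mpr fun h ↦ hnil (h ▸ hσ), Finset.le_sup hσ⟩
  rw [← Finset.sum_fiberwise_of_maps_to hmaps]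
  refine Finset.sum_congr rfl fun k _ ↦ ?_
  rw [blockCount, ← nsmul_eq_mul, ← Finset.sum_const]
  exact Finset.sum_congr rfl fun σ hσ ↦ by rw [(Finset.mem_filter.mp hσ).2]

theorem theorem6 (s : ℕ) (hs : 1 < s) (B : Finset (List (Fin s))) (hne : B.Nonempty)
    (hB : InformationTheory.UniquelyDecodable (B : Set (List (Fin s)))) :
    (∑ k ∈ Finset.Icc 1 (B.sup List.length), blockCount B k = B.card) ∧
    ∃ α₀ : NNReal, dimH (blockSet s B) = (α₀ : ENNReal) ∧
      ∑ k ∈ Finset.Icc 1 (B.sup List.length),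
        (blockCount B k : ℝ) * ((1 : ℝ) / (s : ℝ)) ^ ((k : ℝ) * (α₀ : ℝ)) = 1 := by
  have hnil : [] ∉ B := by simpa using hB.epsilon_not_mem
  refine ⟨by simpa using sum_blockCount_mul hnil fun _ ↦ (1 : ℕ), ?_⟩
  obtain ⟨α, hα⟩ := exists_sum_rpow_pow_length_eq_one hs hne hnil
  refine ⟨α, le_antisymm (dimH_blockSet_le hs hnil α hα)
    (le_dimH_blockSet_of_sum_eq_one hs hB α hα), ?_⟩
  rw [sum_blockCount_mul hnil fun k ↦ ((1 : ℝ) / (s : ℝ)) ^ ((k : ℝ) * (α : ℝ))]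
  refine (Finset.sum_congr rfl fun σ _ ↦ ?_).trans hα
  rw [mul_comm, Real.rpow_mul (by positivity), Real.rpow_natCast]
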